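/- Call a real polynomial $f(x)$ of degree $d$ \emph{magic positive} if $f(x)=\sum_{i=0}^{d} b_i\,x^i(x+1)^{d-i}$ with $b_0,\dots,b_d\ge 0$. For a lattice polytope $P\subset\mathbb{R}^n$, the \emph{Ehrhart polynomial} $E_P$ is the polynomial with $E_P(t)=|tP\cap\mathbb{Z}^n|$ for all integers $t>0$, and the \emph{m-index} of $P$ is $$\operatorname{m-index}(P)=\min\{k\in\mathbb{Z}_{>0} : E_{kP}\text{ is magic positive}\}.$$ For positive integers $k\le n$ let $\Delta_{k,n}=\{(x_1,\dots,x_n)\in[0,1]^n : \sum_{i=1}^n x_i=k\}$ be the $(k,n)$-hypersimplex. Then: (1) For every $n\ge 2$, $\operatorname{m-index}(\Delta_{1,n})=n-1$. (2) For every $n\ge 4$, the Ehrhart polynomial of $\lfloor n/2\rfloor\,\Delta_{2,n}$ is magic positive. In particular, $\operatorname{m-index}(\Delta_{2,n})\le\lfloor n/2\rfloor$. (3) For every $n\ge 6$, the Ehrhart polynomial of $\lfloor n/2\rfloor\,\Delta_{3,n}$ is magic positive. In particular, $\operatorname{m-index}(\Delta_{3,n})\le\lfloor n/2\rfloor$.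 -/

import Mathlib

open scoped Pointwise

/-- A real polynomial `f` of degree `d` is magic positive if it can be written as
`f = ∑_{i=0}^d b_i x^i (x+1)^{d-i}` with all `b_i ≥ 0`. (The `x^i (x+1)^{d-i}`, `0 ≤ i ≤ d`, form
a basis of the polynomials of degree at most `d`, so the `b_i` are determined by `f`.) -/
def MagicPositive (f : Polynomial ℝ) : Prop :=
  ∃ b : ℕ → ℝ, (∀ i, 0 ≤ b i) ∧
    f = ∑ i ∈ Finset.range (f.natDegree + 1),
      Polynomial.C (b i) * Polynomial.X ^ i * (Polynomial.X + 1) ^ (f.natDegree - i)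

/-- The number `|P ∩ ℤ^n|` of lattice points of a (bounded) set `P ⊆ ℝ^n`. -/
noncomputable def latticePointCount {n : ℕ} (P : Set (Fin n → ℝ)) : ℕ :=
  Set.ncard {z : Fin n → ℤ | (fun i => (z i : ℝ)) ∈ P}

/-- `f` is the Ehrhart polynomial of `P`: `f(t) = |tP ∩ ℤ^n|` for all integers `t > 0`. -/
def IsEhrhartPolynomial {n : ℕ} (P : Set (Fin n → ℝ)) (f : Polynomial ℝ) : Prop :=
  ∀ t : ℕ, 0 < t → f.eval (t : ℝ) = (latticePointCount ((t : ℝ) • P) : ℝ)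

/-- A set has at most one Ehrhart polynomial. -/
theorem IsEhrhartPolynomial.unique {n : ℕ} {P : Set (Fin n → ℝ)} {f g : Polynomial ℝ}
    (hf : IsEhrhartPolynomial P f) (hg : IsEhrhartPolynomial P g) : f = g := by
  refine Polynomial.eq_of_infinite_eval_eq f g ?_
  refine Set.Infinite.mono (s := Set.range fun t : ℕ => ((t + 1 : ℕ) : ℝ)) ?_ ?_
  · rintro _ ⟨t, rfl⟩
    exact (hf (t + 1) t.succ_pos).trans (hg (t + 1) t.succ_pos).symm
  · exact Set.infinite_range_of_injective fun a b h => by simpa using h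

/-- The set `P` has an Ehrhart polynomial, and this (unique) polynomial is magic positive. -/
def EhrhartMagicPositive {n : ℕ} (P : Set (Fin n → ℝ)) : Prop :=
  ∃ f : Polynomial ℝ, IsEhrhartPolynomial P f ∧ MagicPositive f

/-- The m-index of `P`: the least integer `k > 0` such that the Ehrhart polynomial of `kP` is magic
positive, and `⊤` if there is no such `k`. -/
noncomputable def mIndex {n : ℕ} (P : Set (Fin n → ℝ)) : ℕ∞ :=
  ⨅ k ∈ {k : ℕ | 0 < k ∧ EhrhartMagicPositive ((k : ℝ) • P)}, (k : ℕ∞)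

/-- The hypersimplex `Δ_{k,n} = {x ∈ [0,1]^n : ∑ x_i = k}`. -/
def hypersimplex (k n : ℕ) : Set (Fin n → ℝ) :=
  {x | (∀ i, x i ∈ Set.Icc (0 : ℝ) 1) ∧ ∑ i, x i = (k : ℝ)}

open Polynomial

/-! Put d = n - 1. Expanding (1 + X + ... + X^s)^n = (1 - X^(s+1))^n (1 - X)^(-n) shows that d!
times the number of lattice points of s Δ_{k,n} is the alternating sum over j < k of (-1)^j C(n,j)
∏_{i=1}^d ((k-j)s + i - j), provided s + 1 ≥ k. With s = tm and y = t/(t+1), a factor ct + i equals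
(t+1)((c-i)y + i), while t^j (t+1)^(d-j) equals (t+1)^d y^j. So magic positivity amounts to
nonnegativity of the coefficients of an explicit polynomial B(y) (`ehrhartMagicPositive_of_eval`).

For k = 1, B is the product of the (m-i)y + i with 1 ≤ i ≤ d, which is fine once m ≥ d. If m < d,
the Ehrhart polynomial vanishes at -d/m < -1, where all x^i (x+1)^(d-i) are nonzero of the same
sign, so it cannot be magic positive.

For k = 2, 3 and m = ⌊n/2⌋, the terms of the alternating sum are compared coefficientwise
(`CoeffDominated`), matching factors with the same constant term i. Consecutive products are shifted
by one index; the unmatched factors are used to absorb the binomial coefficients. For k = 2 the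
second term is dominated by the first (`coeffDominated_two`). For k = 3 write B = F₃ - F₂ + F₁,
binomials included: (4/3)F₂ is dominated by F₃ (`coeffDominated_three_second`, for m ≥ 16) and 3F₁
by F₂ (`coeffDominated_three_third`), so B ≥ F₃ - (4/3)F₂ ≥ 0 coefficientwise. The cases 3 ≤ m ≤ 15
are an integer computation. -/

/-! ### Lattice points of dilated hypersimplices -/

theorem mem_smul_smul_hypersimplex {n : ℕ} (k t m : ℕ) (h : 0 < t * m) (x : Fin n → ℝ) :
    x ∈ (t : ℝ) • ((m : ℝ) • hypersimplex k n) ↔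
      (∀ i, 0 ≤ x i ∧ x i ≤ (t * m : ℕ)) ∧ ∑ i, x i = (k * (t * m) : ℕ) := by
  have h' : (0 : ℝ) < (t * m : ℕ) := by exact_mod_cast h
  rw [smul_smul, ← Nat.cast_mul, Set.mem_smul_set_iff_inv_smul_mem₀ h'.ne']
  simp only [hypersimplex, Set.mem_ofPred_eq, Pi.smul_apply, smul_eq_mul, Set.mem_Icc,
    ← Finset.mul_sum]
  refine and_congr (forall_congr' fun i => and_congr ?_ ?_) ?_
  · exact mul_nonneg_iff_of_pos_left (inv_pos.2 h')
  · rw [inv_mul_le_iff₀ h', mul_one]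
  · rw [inv_mul_eq_iff_eq_mul₀ h'.ne']
    push_cast
    rw [mul_comm]

theorem latticePointCount_smul_smul_hypersimplex {n : ℕ} (k t m : ℕ) (h : 0 < t * m) :
    latticePointCount ((t : ℝ) • ((m : ℝ) • hypersimplex k n)) =
      ((Fintype.piFinset fun _ : Fin n => Finset.range (t * m + 1)).filter
        fun p => ∑ i, p i = k * (t * m)).card := by
  rw [latticePointCount, ← Set.ncard_coe_finset]
  have hinj : Function.Injective fun (p : Fin n → ℕ) (i : Fin n) => (p i : ℤ) := by
    intro p q hpq
    funext i
    have := congrFun hpq i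
    simpa using this
  rw [← Set.ncard_image_of_injective _ hinj]
  congr 1
  ext z
  simp only [mem_smul_smul_hypersimplex k t m h, Set.mem_ofPred_eq, Set.mem_image,
    Finset.coe_filter, Fintype.mem_piFinset, Finset.mem_range]
  constructor
  · rintro ⟨h1, h2⟩
    have h0 : ∀ i, 0 ≤ z i := fun i => by exact_mod_cast (h1 i).1
    have hz : (fun i => ((z i).toNat : ℤ)) = z := funext fun i => Int.toNat_of_nonneg (h0 i)
    refine ⟨fun i => (z i).toNat, ⟨fun i => ?_, ?_⟩, hz⟩
    · have : z i ≤ (t * m : ℕ) := by exact_mod_cast (h1 i).2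
      have := h0 i
      dsimp only
      omega
    · zify
      rw [Finset.sum_congr rfl fun i _ => Int.toNat_of_nonneg (h0 i)]
      exact_mod_cast h2
  · rintro ⟨p, ⟨h1, h2⟩, rfl⟩
    refine ⟨fun i => ⟨by positivity, ?_⟩, ?_⟩
    · have := Nat.lt_succ_iff.1 (h1 i)
      dsimp only
      exact_mod_cast this
    · exact_mod_cast h2

theorem card_filter_sum_eq_coeff (n s N : ℕ) :
    ((((Fintype.piFinset fun _ : Fin n => Finset.range (s + 1)).filter
        fun p => ∑ i, p i = N).card : ℕ) : ℤ) =
      PowerSeries.coeff N ((∑ i ∈ Finset.range (s + 1), (PowerSeries.X : PowerSeries ℤ) ^ i) ^ n) := by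
  have := Finset.prod_univ_sum (fun _ : Fin n => Finset.range (s + 1))
    (fun _ j => (PowerSeries.X : PowerSeries ℤ) ^ j)
  rw [Finset.prod_const, Finset.card_univ, Fintype.card_fin] at this
  rw [this, map_sum, Finset.card_filter]
  push_cast
  refine Finset.sum_congr rfl fun p _ => ?_
  rw [Finset.prod_pow_eq_pow_sum, PowerSeries.coeff_X_pow]
  simp [eq_comm]

theorem geom_sum_pow_eq (d s : ℕ) :
    (∑ i ∈ Finset.range (s + 1), (PowerSeries.X : PowerSeries ℤ) ^ i) ^ (d + 1) =
      ∑ j ∈ Finset.range (d + 2), PowerSeries.C ((-1 : ℤ) ^ j * ((d + 1).choose j : ℤ)) *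
        (PowerSeries.X ^ ((s + 1) * j) * PowerSeries.mk fun k => ((d + k).choose d : ℤ)) := by
  have h1 : ((1 : PowerSeries ℤ) - PowerSeries.X) ^ (d + 1) *
      (PowerSeries.mk fun k => ((d + k).choose d : ℤ)) = 1 := by
    have := (PowerSeries.invOneSubPow ℤ (d + 1)).inv_val
    rwa [PowerSeries.invOneSubPow_val_succ_eq_mk_add_choose,
      PowerSeries.invOneSubPow_inv_eq_one_sub_pow] at this
  have h2 := geom_sum_mul_neg (PowerSeries.X : PowerSeries ℤ) (s + 1)
  have h3 : (1 - (PowerSeries.X : PowerSeries ℤ) ^ (s + 1)) ^ (d + 1) =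
      ∑ j ∈ Finset.range (d + 2), PowerSeries.C ((-1 : ℤ) ^ j * ((d + 1).choose j : ℤ)) *
        PowerSeries.X ^ ((s + 1) * j) := by
    rw [sub_eq_neg_add, add_pow]
    refine Finset.sum_congr rfl fun j _ => ?_
    rw [neg_pow, pow_mul]
    simp
    ring
  simp_rw [← mul_assoc]
  rw [← Finset.sum_mul, ← h3, ← h2, mul_pow, mul_assoc, h1, mul_one]

/-- The j-th term of the expansion contributes exactly when (s+1)j ≤ ks. Since k ≤ s + 1, this means
j < k, so the natural subtraction below is never truncated. -/
theorem card_filter_sum_eq (d s k : ℕ) (hk0 : 0 < k) (hk : k ≤ d + 2) (hs : k ≤ s + 1) :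
    ((((Fintype.piFinset fun _ : Fin (d + 1) => Finset.range (s + 1)).filter
        fun p => ∑ i, p i = k * s).card : ℕ) : ℤ) =
      ∑ j ∈ Finset.range k, (-1 : ℤ) ^ j * ((d + 1).choose j : ℤ) *
        ((d + (k * s - (s + 1) * j)).choose d : ℤ) := by
  rw [card_filter_sum_eq_coeff, geom_sum_pow_eq, map_sum]
  have hsub : Finset.range k ⊆ Finset.range (d + 2) := Finset.range_subset_range.2 hk
  rw [← Finset.sum_subset hsub]
  · refine Finset.sum_congr rfl fun j hj => ?_
    have hj := Finset.mem_range.1 hj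
    have : (s + 1) * j ≤ k * s := by
      obtain ⟨e, rfl⟩ : ∃ e, k = j + 1 + e := ⟨k - (j + 1), by omega⟩
      nlinarith
    rw [PowerSeries.coeff_C_mul, PowerSeries.coeff_X_pow_mul', if_pos this, PowerSeries.coeff_mk]
  · intro j _ hj
    have hj : k ≤ j := by simpa using hj
    have : ¬ (s + 1) * j ≤ k * s := by nlinarith
    rw [PowerSeries.coeff_C_mul, PowerSeries.coeff_X_pow_mul', if_neg this, mul_zero]

theorem factorial_mul_choose_eq_prod (a d : ℕ) :
    ((d.factorial : ℝ) * ((d + a).choose d : ℝ)) = ∏ i ∈ Finset.range d, ((a : ℝ) + (i + 1)) := by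
  have h := Nat.ascFactorial_eq_factorial_mul_choose a d
  rw [add_comm a d, Nat.ascFactorial_eq_prod_range] at h
  rw [← Nat.cast_mul, ← h]
  push_cast
  exact Finset.prod_congr rfl fun i _ => by ring

/-! ### Magic positivity in the variable y = t/(t+1) -/

/-- The linear polynomial `(c - i) y + i`. With `y = t / (t + 1)` it equals
`(c t + i) / (t + 1)`. -/
noncomputable def linFactor (c i : ℝ) : ℝ[X] := C (c - i) * X + C i

theorem coeff_linear_zero (a b : ℝ) : (C a * X + C b).coeff 0 = b := by simp

theorem coeff_linear_one (a b : ℝ) : (C a * X + C b).coeff 1 = a := by simp [coeff_C]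

theorem coeff_linear_succ_succ (a b : ℝ) (j : ℕ) : (C a * X + C b).coeff (j + 2) = 0 := by
  simp

theorem mul_eval_linFactor (c i t : ℝ) (ht : t + 1 ≠ 0) :
    (t + 1) * (linFactor c i).eval (t / (t + 1)) = c * t + i := by
  simp only [linFactor, eval_add, eval_mul, eval_C, eval_X]
  field_simp
  ring

theorem pow_mul_eval_prod_linFactor (c t : ℝ) (ht : t + 1 ≠ 0) (d : ℕ) (g : ℕ → ℝ) :
    (t + 1) ^ d * (∏ i ∈ Finset.range d, linFactor c (g i)).eval (t / (t + 1)) =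
      ∏ i ∈ Finset.range d, (c * t + g i) := by
  rw [eval_prod]
  nth_rewrite 1 [← Finset.card_range d]
  rw [← Finset.prod_const, ← Finset.prod_mul_distrib]
  exact Finset.prod_congr rfl fun i _ => mul_eval_linFactor c (g i) t ht

theorem natDegree_linFactor_le (c i : ℝ) : (linFactor c i).natDegree ≤ 1 :=
  natDegree_linear_le

theorem natDegree_prod_linFactor_le (c : ℝ) (d : ℕ) (g : ℕ → ℝ) :
    (∏ i ∈ Finset.range d, linFactor c (g i)).natDegree ≤ d := by
  refine (natDegree_prod_le _ _).trans ?_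
  refine (Finset.sum_le_card_nsmul _ _ 1 fun i _ => natDegree_linFactor_le c (g i)).trans ?_
  simp

/-- Every basis polynomial is monic of degree d, so the coefficient of X^d is the sum of the b_i.
This reconciles the expected degree d with the `natDegree` in `MagicPositive`. -/
theorem natDegree_magic_sum (d : ℕ) (b : ℕ → ℝ) (hb : ∑ i ∈ Finset.range (d + 1), b i ≠ 0) :
    (∑ i ∈ Finset.range (d + 1), C (b i) * X ^ i * (X + 1 : ℝ[X]) ^ (d - i)).natDegree = d := by
  have hX : (X + 1 : ℝ[X]).Monic := by simpa using monic_X_add_C (1 : ℝ)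
  have hmon : ∀ i ∈ Finset.range (d + 1), (X ^ i * (X + 1 : ℝ[X]) ^ (d - i)).Monic ∧
      (X ^ i * (X + 1 : ℝ[X]) ^ (d - i)).natDegree = d := by
    intro i hi
    have hi := Finset.mem_range.1 hi
    refine ⟨(monic_X_pow i).mul (hX.pow _), ?_⟩
    rw [(monic_X_pow i).natDegree_mul (hX.pow _), natDegree_X_pow, hX.natDegree_pow,
      show (X + 1 : ℝ[X]) = X + C 1 by simp, natDegree_X_add_C]
    omega
  refine natDegree_eq_of_le_of_coeff_ne_zero (natDegree_sum_le_of_forall_le _ _ fun i hi => ?_) ?_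
  · rw [mul_assoc]
    exact (natDegree_C_mul_le _ _).trans (hmon i hi).2.le
  · rw [finsetSum_coeff]
    convert hb using 1
    refine Finset.sum_congr rfl fun i hi => ?_
    rw [mul_assoc, coeff_C_mul]
    nth_rewrite 2 [← (hmon i hi).2]
    rw [(hmon i hi).1.coeff_natDegree, mul_one]

/-- Since (t+1)^d y^j = t^j (t+1)^(d-j), the coefficients of B divided by d! serve as the b_j.
Positivity of the constant one keeps their sum nonzero, hence the degree equal to d. -/
theorem ehrhartMagicPositive_of_eval {n : ℕ} {P : Set (Fin n → ℝ)} (d : ℕ) (B : ℝ[X])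
    (hdeg : B.natDegree ≤ d) (hB : ∀ j, 0 ≤ B.coeff j) (h0 : 0 < B.coeff 0)
    (heval : ∀ t : ℕ, 0 < t → (d.factorial : ℝ) * (latticePointCount ((t : ℝ) • P) : ℝ) =
      ((t : ℝ) + 1) ^ d * B.eval ((t : ℝ) / ((t : ℝ) + 1))) :
    EhrhartMagicPositive P := by
  have hd : (0 : ℝ) < d.factorial := by exact_mod_cast d.factorial_pos
  set b : ℕ → ℝ := fun j => (d.factorial : ℝ)⁻¹ * B.coeff j with hb
  have hb0 : ∀ i, 0 ≤ b i := fun i => mul_nonneg (inv_nonneg.2 hd.le) (hB i)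
  have hsum : ∑ i ∈ Finset.range (d + 1), b i ≠ 0 := by
    refine (Finset.sum_pos' (fun i _ => hb0 i) ⟨0, by simp, mul_pos (inv_pos.2 hd) h0⟩).ne'
  refine ⟨∑ i ∈ Finset.range (d + 1), C (b i) * X ^ i * (X + 1 : ℝ[X]) ^ (d - i), ?_, b, hb0, ?_⟩
  · intro t ht
    have ht1 : (t : ℝ) + 1 ≠ 0 := by positivity
    refine mul_left_cancel₀ hd.ne' ?_
    rw [heval t ht, eval_finsetSum, eval_eq_sum_range' (Nat.lt_succ_of_le hdeg), Finset.mul_sum,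
      Finset.mul_sum]
    refine Finset.sum_congr rfl fun i hi => ?_
    have hi : i ≤ d := Nat.lt_succ_iff.1 (Finset.mem_range.1 hi)
    simp only [eval_mul, eval_C, eval_pow, eval_X, eval_add, eval_one, hb]
    obtain ⟨e, rfl⟩ := Nat.exists_eq_add_of_le hi
    rw [Nat.add_sub_cancel_left, div_pow, pow_add]
    field_simp
  · rw [natDegree_magic_sum d b hsum]

theorem mIndex_le {n k : ℕ} {P : Set (Fin n → ℝ)} (hk : 0 < k)
    (h : EhrhartMagicPositive ((k : ℝ) • P)) : mIndex P ≤ (k : ℕ∞) :=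
  iInf₂_le k ⟨hk, h⟩

/-! ### The standard simplex, k = 1 -/

theorem count_hypersimplex_one (d k t : ℕ) (h : 0 < t * k) :
    (d.factorial : ℝ) *
      (latticePointCount ((t : ℝ) • ((k : ℝ) • hypersimplex 1 (d + 1))) : ℝ) =
      ∏ i ∈ Finset.range d, ((k : ℝ) * t + (i + 1)) := by
  have := card_filter_sum_eq d (t * k) 1 one_pos (by omega) (by omega)
  rw [latticePointCount_smul_smul_hypersimplex 1 t k h]
  have hc := congrArg (Int.cast : ℤ → ℝ) this
  push_cast at hc
  rw [Finset.sum_range_one] at hc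
  rw [hc]
  have h2 := factorial_mul_choose_eq_prod (t * k) d
  push_cast at h2
  rw [pow_zero, Nat.choose_zero_right, Nat.cast_one, one_mul, one_mul, mul_zero, Nat.sub_zero,
    one_mul, h2]
  exact Finset.prod_congr rfl fun i _ => by rw [mul_comm (t : ℝ)]

theorem ehrhartMagicPositive_hypersimplex_one (d k : ℕ) (hk : 0 < k) (hdk : d ≤ k) :
    EhrhartMagicPositive ((k : ℝ) • hypersimplex 1 (d + 1)) := by
  refine ehrhartMagicPositive_of_eval d
    (∏ i ∈ Finset.range d, linFactor k ((i : ℝ) + 1)) (natDegree_prod_linFactor_le _ _ _) ?_ ?_ ?_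
  · refine Finset.prod_induction _ (fun p : ℝ[X] => ∀ j, 0 ≤ p.coeff j) ?_ ?_ ?_
    · intro p q hp hq j
      rw [coeff_mul]
      exact Finset.sum_nonneg fun x _ => mul_nonneg (hp _) (hq _)
    · intro j
      rw [coeff_one]
      split_ifs <;> norm_num
    · intro i hi j
      have : (i : ℝ) + 1 ≤ k := by
        have := Finset.mem_range.1 hi
        exact_mod_cast (by omega : i + 1 ≤ k)
      rcases j with _ | _ | j
      · rw [linFactor, coeff_linear_zero]; positivity
      · rw [linFactor, zero_add, coeff_linear_one]; exact sub_nonneg.2 this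
      · rw [linFactor, coeff_linear_succ_succ]
  · rw [coeff_zero_prod]
    exact Finset.prod_pos fun i _ => by rw [linFactor, coeff_linear_zero]; positivity
  · intro t ht
    rw [count_hypersimplex_one d k t (by positivity),
      pow_mul_eval_prod_linFactor (k : ℝ) t (by positivity) d fun i => (i : ℝ) + 1]

theorem le_of_ehrhartMagicPositive_hypersimplex_one (d k : ℕ) (hd : 0 < d) (hk : 0 < k)
    (h : EhrhartMagicPositive ((k : ℝ) • hypersimplex 1 (d + 1))) : d ≤ k := by
  by_contra! hkd
  obtain ⟨f, hf, b, hb, hfb⟩ := h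
  have hk' : (0 : ℝ) < k := by exact_mod_cast hk
  set g : ℝ[X] := ∏ i ∈ Finset.range d, (C (k : ℝ) * X + C ((i : ℝ) + 1)) with hg
  have hfg : C (d.factorial : ℝ) * f = g := by
    refine eq_of_infinite_eval_eq _ _
      (Set.Infinite.mono (s := Set.range fun t : ℕ => ((t + 1 : ℕ) : ℝ)) ?_
      (Set.infinite_range_of_injective fun a b h => by simpa using h))
    rintro _ ⟨t, rfl⟩
    show eval _ _ = eval _ _
    rw [eval_mul, eval_C, hf (t + 1) t.succ_pos,
      count_hypersimplex_one d k (t + 1) (by positivity), hg, eval_prod]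
    simp
  have hd' : (d.factorial : ℝ) ≠ 0 := by exact_mod_cast d.factorial_ne_zero
  have hg0 : g ≠ 0 := Finset.prod_ne_zero_iff.2 fun i _ h => by
    have := congrArg (fun p : ℝ[X] => p.coeff 1) h
    rw [coeff_linear_one] at this
    exact hk'.ne' this
  -- The zero of the last factor kt + d; it lies below -1 because k < d.
  set x : ℝ := -(d : ℝ) / k with hx
  have hgx : g.eval x = 0 := by
    rw [hg, eval_prod]
    refine Finset.prod_eq_zero (Finset.mem_range.2 (by omega : d - 1 < d)) ?_
    simp only [eval_add, eval_mul, eval_C, eval_X, hx]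
    rw [Nat.cast_sub hd]
    field_simp
    simp
  have hfx : f.eval x = 0 := by
    rw [← hfg, eval_mul, eval_C] at hgx
    exact (mul_eq_zero.1 hgx).resolve_left hd'
  have hx0 : x < 0 := div_neg_of_neg_of_pos (by simpa using hd) hk'
  have hx1 : x + 1 < 0 := by
    rw [hx, div_add_one hk'.ne']
    refine div_neg_of_neg_of_pos ?_ hk'
    have : (k : ℝ) < d := by exact_mod_cast hkd
    linarith
  -- Multiplying by (-1)^(deg f) makes the value of every basis polynomial at x positive.
  have hsum : ∑ i ∈ Finset.range (f.natDegree + 1),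
      b i * ((-x) ^ i * (-(x + 1)) ^ (f.natDegree - i)) = 0 := by
    have hfx := hfx
    rw [congrArg (eval x) hfb, eval_finsetSum] at hfx
    rw [← mul_zero ((-1 : ℝ) ^ f.natDegree), ← hfx, Finset.mul_sum]
    refine Finset.sum_congr rfl fun i hi => ?_
    have hi : i ≤ f.natDegree := Nat.lt_succ_iff.1 (Finset.mem_range.1 hi)
    simp only [eval_mul, eval_C, eval_pow, eval_X, eval_add, eval_one]
    rw [neg_pow x, neg_pow (x + 1)]
    nth_rewrite 3 [← Nat.add_sub_cancel' hi]
    rw [pow_add]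
    ring
  have hpos : ∀ i, 0 < (-x) ^ i * (-(x + 1)) ^ (f.natDegree - i) := fun i =>
    mul_pos (pow_pos (by linarith) _) (pow_pos (by linarith) _)
  have hb0 : ∀ i ∈ Finset.range (f.natDegree + 1), b i = 0 := fun i hi =>
    (mul_eq_zero.1 ((Finset.sum_eq_zero_iff_of_nonneg fun i _ =>
      mul_nonneg (hb i) (hpos i).le).1 hsum i hi)).resolve_right (hpos i).ne'
  have hf0 : f = 0 := by
    rw [hfb]
    exact Finset.sum_eq_zero fun i hi => by rw [hb0 i hi]; simp
  rw [hf0, mul_zero] at hfg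
  exact hg0 hfg.symm

theorem mIndex_hypersimplex_one (n : ℕ) (hn : 2 ≤ n) :
    mIndex (hypersimplex 1 n) = ((n - 1 : ℕ) : ℕ∞) := by
  obtain ⟨d, rfl⟩ : ∃ d, n = d + 1 := ⟨n - 1, by omega⟩
  refine le_antisymm (mIndex_le (by omega)
    (ehrhartMagicPositive_hypersimplex_one d _ (by omega) (by omega))) ?_
  refine le_iInf₂ fun k hk => ?_
  exact_mod_cast le_of_ehrhartMagicPositive_hypersimplex_one d k (by omega) hk.1 hk.2

/-! ### Coefficientwise domination -/

/-- The absolute values of the coefficients of `p` are at most the coefficients of `q`. -/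
def CoeffDominated (p q : ℝ[X]) : Prop := ∀ j, |p.coeff j| ≤ q.coeff j

namespace CoeffDominated

variable {p q r p' q' : ℝ[X]}

theorem trans (h : CoeffDominated p q) (h' : CoeffDominated q r) : CoeffDominated p r :=
  fun j => (h j).trans ((le_abs_self _).trans (h' j))

theorem mul (h : CoeffDominated p q) (h' : CoeffDominated p' q') :
    CoeffDominated (p * p') (q * q') := by
  intro j
  rw [coeff_mul, coeff_mul]
  refine (Finset.abs_sum_le_sum_abs _ _).trans (Finset.sum_le_sum fun x _ => ?_)
  rw [abs_mul]
  exact mul_le_mul (h _) (h' _) (abs_nonneg _) ((abs_nonneg _).trans (h _))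

theorem const {a b : ℝ} (h : |a| ≤ b) : CoeffDominated (C a) (C b) := by
  intro j
  rw [coeff_C, coeff_C]
  split_ifs
  · exact h
  · simp

theorem const_self {a : ℝ} (h : 0 ≤ a) : CoeffDominated (C a) (C a) :=
  const (abs_of_nonneg h).le

theorem linear {a b a' b' : ℝ} (ha : |a| ≤ a') (hb : |b| ≤ b') :
    CoeffDominated (C a * X + C b) (C a' * X + C b') := by
  intro j
  rcases j with _ | _ | j
  · simpa only [coeff_linear_zero] using hb
  · simpa only [zero_add, coeff_linear_one] using ha
  · simp only [coeff_linear_succ_succ, abs_zero, le_refl]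

theorem prod {ι : Type*} (s : Finset ι) (f g : ι → ℝ[X])
    (h : ∀ i ∈ s, CoeffDominated (f i) (g i)) :
    CoeffDominated (∏ i ∈ s, f i) (∏ i ∈ s, g i) := by
  classical
  induction s using Finset.induction_on with
  | empty => simpa using const_self (zero_le_one (α := ℝ))
  | insert a s ha ih =>
    rw [Finset.prod_insert ha, Finset.prod_insert ha]
    exact (h a (Finset.mem_insert_self a s)).mul
      (ih fun i hi => h i (Finset.mem_insert_of_mem hi))

end CoeffDominated

/-! ### Elementary symmetric polynomials under affine substitution -/

theorem coeff_linear_mul_zero (a b : ℝ) (p : ℝ[X]) :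
    ((C a * X + C b) * p).coeff 0 = b * p.coeff 0 := by
  rw [mul_coeff_zero, coeff_linear_zero]

theorem coeff_linear_mul_succ (a b : ℝ) (p : ℝ[X]) (j : ℕ) :
    ((C a * X + C b) * p).coeff (j + 1) = a * p.coeff j + b * p.coeff (j + 1) := by
  rw [add_mul, coeff_add, mul_assoc, coeff_C_mul, coeff_X_mul, coeff_C_mul]

/-- The polynomial `∏_{i<s} (1 + v_i y)`, whose coefficients are the elementary symmetric
polynomials of `v_0, …, v_{s-1}`. -/
noncomputable def esymmPoly (v : ℕ → ℝ) (s : ℕ) : ℝ[X] :=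
  ∏ i ∈ Finset.range s, (C (v i) * X + C 1)

theorem esymmPoly_succ (v : ℕ → ℝ) (s : ℕ) :
    esymmPoly v (s + 1) = (C (v s) * X + C 1) * esymmPoly v s := by
  rw [esymmPoly, Finset.prod_range_succ, mul_comm, esymmPoly]

theorem esymmPoly_succ' (v : ℕ → ℝ) (s : ℕ) :
    esymmPoly v (s + 1) = (C (v 0) * X + C 1) * esymmPoly (fun i => v (i + 1)) s := by
  rw [esymmPoly, Finset.prod_range_succ', mul_comm, esymmPoly]

theorem esymmPoly_coeff_zero (v : ℕ → ℝ) (s : ℕ) : (esymmPoly v s).coeff 0 = 1 := by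
  induction s with
  | zero => simp [esymmPoly]
  | succ s ih => rw [esymmPoly_succ, coeff_linear_mul_zero, ih, one_mul]

theorem esymmPoly_coeff_nonneg (v : ℕ → ℝ) (s : ℕ) (hv : ∀ i < s, 0 ≤ v i) (j : ℕ) :
    0 ≤ (esymmPoly v s).coeff j := by
  induction s generalizing j with
  | zero => simp only [esymmPoly, Finset.range_zero, Finset.prod_empty, coeff_one]; positivity
  | succ s ih =>
    have ih := ih fun i hi => hv i (by omega)
    rw [esymmPoly_succ]
    rcases j with _ | j
    · rw [coeff_linear_mul_zero, one_mul]; exact ih 0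
    · rw [coeff_linear_mul_succ, one_mul]
      exact add_nonneg (mul_nonneg (hv s (by omega)) (ih j)) (ih _)

theorem esymmPoly_coeff_eq_zero (v : ℕ → ℝ) (s j : ℕ) (h : s < j) :
    (esymmPoly v s).coeff j = 0 := by
  induction s generalizing j with
  | zero =>
    simp only [esymmPoly, Finset.range_zero, Finset.prod_empty, coeff_one, if_neg h.ne']
  | succ s ih =>
    obtain ⟨j, rfl⟩ : ∃ i, j = i + 1 := ⟨j - 1, by omega⟩
    rw [esymmPoly_succ, coeff_linear_mul_succ, ih j (by omega), ih (j + 1) (by omega)]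
    simp

/-- In the expansion of e_{j+1}(av + b) keep only the terms using b at most once: each j-subset can
be extended by an index carrying b in s - j ways. -/
theorem le_esymmPoly_affine_coeff_succ (v : ℕ → ℝ) (a b : ℝ) (ha : 0 ≤ a) (hb : 0 ≤ b) (s : ℕ)
    (hv : ∀ i < s, 0 ≤ v i) (j : ℕ) :
    a ^ (j + 1) * (esymmPoly v s).coeff (j + 1) +
        a ^ j * b * ((s : ℝ) - j) * (esymmPoly v s).coeff j ≤
      (esymmPoly (fun i => a * v i + b) s).coeff (j + 1) := by
  induction s generalizing j with
  | zero =>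
    rcases j with _ | j
    · simp [esymmPoly, coeff_one]
    · simp [esymmPoly, coeff_one]
  | succ s ih =>
    have hv' : ∀ i < s, 0 ≤ v i := fun i hi => hv i (by omega)
    have ih := ih hv'
    have hvs := hv s (by omega)
    rw [esymmPoly_succ, esymmPoly_succ, coeff_linear_mul_succ, coeff_linear_mul_succ]
    have h1 := ih j
    set P := esymmPoly v s
    set Q := esymmPoly (fun i => a * v i + b) s
    push_cast
    rcases j with _ | j
    · have hP : P.coeff 0 = 1 := esymmPoly_coeff_zero _ _
      have hQ : Q.coeff 0 = 1 := esymmPoly_coeff_zero _ _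
      rw [coeff_linear_mul_zero, hP, hQ]
      rw [hP] at h1
      simp only [zero_add, pow_zero, pow_one, Nat.cast_zero] at h1 ⊢
      linarith
    · have h2 := ih j
      have hP : ∀ j, 0 ≤ P.coeff j := esymmPoly_coeff_nonneg v s hv'
      rw [coeff_linear_mul_succ]
      have h3 := mul_le_mul_of_nonneg_left h2 (mul_nonneg ha hvs)
      have h4 : a ^ (j + 1) * P.coeff (j + 1) ≤ Q.coeff (j + 1) := by
        rcases Nat.lt_or_ge s j with h | h
        · have e0 : P.coeff (j + 1) = 0 := esymmPoly_coeff_eq_zero _ _ _ (by omega)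
          have e1 : P.coeff j = 0 := esymmPoly_coeff_eq_zero _ _ _ h
          rw [e0, e1] at h2
          rw [e0]
          linarith
        · have : (0 : ℝ) ≤ (s : ℝ) - j := sub_nonneg.2 (by exact_mod_cast h)
          have := hP j
          have : 0 ≤ a ^ j * b * ((s : ℝ) - j) * P.coeff j := by positivity
          linarith
      have h5 := mul_le_mul_of_nonneg_left h4 hb
      push_cast at h1 ⊢
      calc _ = (a ^ (j + 1 + 1) * P.coeff (j + 1 + 1) +
              a ^ (j + 1) * b * ((s : ℝ) - (j + 1)) * P.coeff (j + 1)) +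
            a * v s * (a ^ (j + 1) * P.coeff (j + 1) + a ^ j * b * ((s : ℝ) - j) * P.coeff j) +
            b * (a ^ (j + 1) * P.coeff (j + 1)) := by ring
        _ ≤ Q.coeff (j + 1 + 1) + a * v s * Q.coeff (j + 1) + b * Q.coeff (j + 1) := by
            linarith
        _ = _ := by ring

theorem linFactor_eq_C_mul (c a b i v : ℝ) (hi : i ≠ 0) (h : a * v + b = c / i - 1) :
    linFactor c i = C i * (C (a * v + b) * X + C 1) := by
  rw [h, linFactor, mul_add, ← mul_assoc, ← C_mul, ← C_mul, mul_one, mul_sub,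
    mul_div_cancel₀ _ hi, mul_one]

/-- Normalizing constant terms to 1 replaces c by the slopes c/i - 1. Scaling c by λ acts on these
slopes by v ↦ λv + (λ - 1), the affine substitution treated above. -/
theorem prod_linFactor_eq (c a b : ℝ) (g v : ℕ → ℝ) (s : ℕ)
    (h : ∀ i, g i ≠ 0 ∧ a * v i + b = c / g i - 1) :
    ∏ i ∈ Finset.range s, linFactor c (g i) =
      C (∏ i ∈ Finset.range s, g i) * esymmPoly (fun i => a * v i + b) s := by
  rw [esymmPoly, map_prod, ← Finset.prod_mul_distrib]
  exact Finset.prod_congr rfl fun i _ => linFactor_eq_C_mul _ _ _ _ _ (h i).1 (h i).2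

theorem add_two_le_two_pow_mul (j r : ℕ) (hj : 1 ≤ j) (hr : 1 ≤ r) (h : 3 ≤ j + r) :
    j + r + 1 ≤ 2 ^ j * r := by
  have h1 : j + 1 ≤ 2 ^ j := Nat.lt_two_pow_self
  rcases Nat.lt_or_ge r 2 with h2 | h2
  · obtain rfl : r = 1 := by omega
    obtain ⟨i, rfl⟩ : ∃ i, j = i + 1 := ⟨j - 1, by omega⟩
    have : i + 1 ≤ 2 ^ i := Nat.lt_two_pow_self
    rw [pow_succ]
    omega
  · nlinarith

/-- Doubling c turns the slopes v into 2v + 1, and the resulting gain in the elementary symmetric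
polynomials pays for the additional factor (m+1)y + 1. -/
theorem coeffDominated_prod_linFactor_self_two_mul (m : ℕ) (hm : 2 ≤ m) :
    CoeffDominated
      ((C ((m : ℝ) + 1) * X + C 1) * ∏ i ∈ Finset.range m, linFactor m ((i : ℝ) + 1))
      (∏ i ∈ Finset.range m, linFactor (2 * m) ((i : ℝ) + 1)) := by
  -- For m = 2 both sides are equal; the estimate below needs m ≥ 3.
  rcases hm.eq_or_lt with rfl | hm
  · have e : (C (((2 : ℕ) : ℝ) + 1) * X + C 1) *
        ∏ i ∈ Finset.range 2, linFactor ((2 : ℕ) : ℝ) ((i : ℝ) + 1) =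
        ∏ i ∈ Finset.range 2, linFactor (2 * ((2 : ℕ) : ℝ)) ((i : ℝ) + 1) := by
      simp only [Finset.prod_range_succ, Finset.prod_range_zero, linFactor]
      norm_num [C_ofNat]
      left
      ring
    rw [e]
    refine CoeffDominated.prod _ _ _ fun i hi => CoeffDominated.linear ?_ ?_
    · refine (abs_of_nonneg ?_).le
      have : (i : ℝ) ≤ 1 := by exact_mod_cast Nat.lt_succ_iff.1 (Finset.mem_range.1 hi)
      push_cast
      linarith
    · exact (abs_of_nonneg (by positivity)).le
  obtain ⟨s, rfl⟩ : ∃ s, m = s + 1 := ⟨m - 1, by omega⟩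
  set M : ℝ := ((s + 1 : ℕ) : ℝ) with hM
  have hMs : M = (s : ℝ) + 1 := by rw [hM]; push_cast; ring
  have hs2 : (2 : ℝ) ≤ s := by exact_mod_cast (by omega : 2 ≤ s)
  set v : ℕ → ℝ := fun i => M / ((i : ℝ) + 1) - 1 with hv
  have hg : ∀ i : ℕ, (i : ℝ) + 1 ≠ 0 := fun i => by positivity
  have hv0 : ∀ i < s, 0 ≤ v i := fun i hi => by
    have : (i : ℝ) + 1 ≤ M := by rw [hMs]; gcongr
    rw [hv]
    dsimp only
    rw [sub_nonneg, le_div_iff₀ (by positivity)]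
    linarith
  rw [Finset.prod_range_succ, Finset.prod_range_succ,
    prod_linFactor_eq M 1 0 _ v s fun i => ⟨hg i, by rw [hv]; ring⟩,
    prod_linFactor_eq (2 * M) 2 1 _ v s fun i => ⟨hg i, by rw [hv]; ring⟩]
  simp only [one_mul, add_zero]
  set P := esymmPoly v s
  set Q := esymmPoly (fun i => 2 * v i + 1) s
  set c : ℝ := ∏ i ∈ Finset.range s, ((i : ℝ) + 1) with hc
  have hc0 : 0 ≤ c := Finset.prod_nonneg fun i _ => by positivity
  -- The factor with i = m is the constant M on the left and M(y + 1) on the right.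
  have e1 : (C (M + 1) * X + C 1) * (C c * P * linFactor M ((s : ℝ) + 1)) =
      C (c * M) * ((C (M + 1) * X + C 1) * P) := by
    rw [linFactor, ← hMs, sub_self, C_0, C_mul]
    ring
  have e2 : C c * Q * linFactor (2 * M) ((s : ℝ) + 1) = C (c * M) * ((C 1 * X + C 1) * Q) := by
    rw [linFactor, ← hMs, show 2 * M - M = M by ring, C_mul, C_1]
    ring
  rw [e1, e2]
  refine (CoeffDominated.const_self (mul_nonneg hc0 (by rw [hMs]; positivity))).mul ?_
  have hP : ∀ j, 0 ≤ P.coeff j := esymmPoly_coeff_nonneg v s hv0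
  intro j
  rcases j with _ | j
  · rw [coeff_linear_mul_zero, coeff_linear_mul_zero, esymmPoly_coeff_zero, esymmPoly_coeff_zero]
    simp
  rw [coeff_linear_mul_succ, coeff_linear_mul_succ, abs_of_nonneg (add_nonneg
    (mul_nonneg (by linarith) (hP j)) (mul_nonneg zero_le_one (hP _)))]
  have hQ := le_esymmPoly_affine_coeff_succ v 2 1 (by norm_num) (by norm_num) s hv0
  have h1 := hQ j
  rcases j with _ | j
  · have hP0 : P.coeff 0 = 1 := esymmPoly_coeff_zero _ _
    have hQ0 : Q.coeff 0 = 1 := esymmPoly_coeff_zero _ _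
    have hP1 : 1 ≤ P.coeff 1 := by
      obtain ⟨s, rfl⟩ : ∃ r, s = r + 1 := ⟨s - 1, by omega⟩
      have : P = _ := esymmPoly_succ' v s
      rw [this, coeff_linear_mul_succ, esymmPoly_coeff_zero]
      have h2 := esymmPoly_coeff_nonneg (fun i => v (i + 1)) s
        (fun i hi => hv0 (i + 1) (by omega)) 1
      have h3 : (1 : ℝ) ≤ v 0 := by
        rw [hv, hMs]
        norm_num at hs2 ⊢
      rw [zero_add]
      linarith
    change _ ≤ Q.coeff (0 + 1) at h1
    rw [hP0] at h1
    rw [hP0, hQ0]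
    norm_num at h1 ⊢
    linarith
  · have h2 := hQ j
    change _ ≤ Q.coeff (j + 1) at h2
    change _ ≤ Q.coeff (j + 1 + 1) at h1
    rcases Nat.lt_or_ge s (j + 1) with h | h
    · have z1 : P.coeff (j + 1) = 0 := esymmPoly_coeff_eq_zero _ _ _ h
      have z2 : P.coeff (j + 1 + 1) = 0 := esymmPoly_coeff_eq_zero _ _ _ (by omega)
      have : 0 ≤ Q.coeff (j + 1) := by
        refine esymmPoly_coeff_nonneg _ _ (fun i hi => ?_) _
        have := hv0 i hi
        positivity
      rw [z1, z2] at h1 ⊢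
      linarith
    · obtain ⟨r, rfl⟩ := Nat.exists_eq_add_of_le h
      -- With s = j + 1 + r, the bounds `h1` and `h2` together give P_{j+1} the weight 2^(j+1)
      -- (r+1), to be compared with M + 1 = j + r + 3.
      have h3 : ((j : ℝ) + 1 + (r + 1) + 1) ≤ 2 ^ (j + 1) * (r + 1) := by
        exact_mod_cast add_two_le_two_pow_mul (j + 1) (r + 1) (by omega) (by omega) (by omega)
      have h4 := mul_le_mul_of_nonneg_right h3 (hP (j + 1))
      have h5 := hP j
      have h6 : P.coeff (j + 1 + 1) ≤ 2 ^ (j + 1 + 1) * P.coeff (j + 1 + 1) :=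
        le_mul_of_one_le_left (hP _) (one_le_pow₀ (by norm_num))
      have h7 : 0 ≤ 2 ^ j * 1 * (((j + 1 + r : ℕ) : ℝ) - j) * P.coeff j := by
        have : (0 : ℝ) ≤ ((j + 1 + r : ℕ) : ℝ) - j := by push_cast; linarith [(r.cast_nonneg : (0:ℝ) ≤ r)]
        positivity
      rw [hMs]
      push_cast at h1 h2 h7 ⊢
      nlinarith

/-- Among the pairings of two arithmetic progressions, the product of the linear polynomials
has the largest coefficients when the progressions run in opposite directions. -/
theorem coeffDominated_prod_reverse (A B : ℝ) (hA : 0 ≤ A) (hB : 0 ≤ B) (l : ℕ) :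
    CoeffDominated (∏ t ∈ Finset.range l, (C (-(B + t)) * X + C (A + t)))
      (∏ t ∈ Finset.range l, (C (B + (l - 1 - t)) * X + C (A + t))) := by
  induction l using Nat.twoStepInduction generalizing A B with
  | zero => simpa using CoeffDominated.const_self (zero_le_one (α := ℝ))
  | one =>
    simp only [Finset.prod_range_one]
    refine CoeffDominated.linear ?_ ?_
    · rw [abs_neg]; simp [abs_of_nonneg hB]
    · simp [abs_of_nonneg hA]
  | more l ih _ =>
    have h := ih (A + 1) (B + 1) (by positivity) (by positivity)
    have e1 : ∏ t ∈ Finset.range (l + 2), (C (-(B + (t : ℝ))) * X + C (A + (t : ℝ))) =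
        ((C (-B) * X + C A) * (C (-(B + l + 1)) * X + C (A + l + 1))) *
        ∏ t ∈ Finset.range l, (C (-(B + 1 + (t : ℝ))) * X + C (A + 1 + (t : ℝ))) := by
      rw [Finset.prod_range_succ, Finset.prod_range_succ', mul_assoc, mul_comm]
      congr 1
      · push_cast; simp only [add_zero, add_assoc]
      · refine Finset.prod_congr rfl fun t _ => ?_
        push_cast; simp only [add_assoc, add_comm (1 : ℝ)]
    have e2 : ∏ t ∈ Finset.range (l + 2),
          (C (B + (((l + 2 : ℕ) : ℝ) - 1 - t)) * X + C (A + (t : ℝ))) =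
        ((C (B + l + 1) * X + C A) * (C B * X + C (A + l + 1))) *
        ∏ t ∈ Finset.range l, (C (B + 1 + ((l : ℝ) - 1 - t)) * X + C (A + 1 + (t : ℝ))) := by
      rw [Finset.prod_range_succ, Finset.prod_range_succ', mul_assoc, mul_comm]
      congr 1
      · push_cast
        refine congrArg₂ (· * ·)
          (congrArg₂ (· + ·) (congrArg (fun r => C r * X) ?_) (congrArg C ?_))
          (congrArg₂ (· + ·) (congrArg (fun r => C r * X) ?_) (congrArg C ?_)) <;> ring
      · refine Finset.prod_congr rfl fun t _ => ?_
        push_cast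
        refine congrArg₂ (· + ·) (congrArg (fun r => C r * X) ?_) (congrArg C ?_) <;> ring
    rw [e1, e2]
    refine CoeffDominated.mul ?_ h
    have hl : (0 : ℝ) ≤ l := l.cast_nonneg
    -- For the outer pair of factors the extreme coefficients agree on both sides, and the absolute
    -- values of the middle ones differ by (l+1)^2.
    intro j
    rcases j with _ | _ | _ | j
    · rw [coeff_linear_mul_zero, coeff_linear_mul_zero, coeff_linear_zero, coeff_linear_zero,
        abs_of_nonneg (by positivity)]
    · rw [coeff_linear_mul_succ, coeff_linear_mul_succ]
      simp only [zero_add, coeff_linear_zero, coeff_linear_one]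
      rw [abs_le]
      constructor <;> nlinarith
    · rw [coeff_linear_mul_succ, coeff_linear_mul_succ]
      simp only [coeff_linear_succ_succ _ _ 0, coeff_linear_one]
      rw [abs_le]
      constructor <;> nlinarith [mul_nonneg hB hl, mul_nonneg hB hB]
    · rw [coeff_linear_mul_succ, coeff_linear_mul_succ]
      simp only [coeff_linear_succ_succ]
      simp

/-! ### The case k = 3 with small m, by integer arithmetic -/

/-- The coefficient list of `(a y + b) p + a c`, where `l` is the coefficient list of `p`. -/
def mulLinearAux (a b : ℤ) : ℤ → List ℤ → List ℤ
  | c, [] => [a * c]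
  | c, x :: l => (a * c + b * x) :: mulLinearAux a b x l

/-- Sum of coefficient lists. -/
def addCoeffs : List ℤ → List ℤ → List ℤ
  | [], l => l
  | x :: l, [] => x :: l
  | x :: l, y :: l' => (x + y) :: addCoeffs l l'

/-- The coefficient list of `∏_{i<d} (a_i y + b_i)`. -/
def prodLinear (a b : ℕ → ℤ) : ℕ → List ℤ
  | 0 => [1]
  | d + 1 => mulLinearAux (a d) (b d) 0 (prodLinear a b d)

/-- The polynomial with a given coefficient list. -/
noncomputable def ofCoeffs : List ℤ → ℝ[X]
  | [] => 0
  | x :: l => C (x : ℝ) + X * ofCoeffs l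

theorem ofCoeffs_coeff_nonneg (l : List ℤ) (h : ∀ x ∈ l, 0 ≤ x) (j : ℕ) :
    0 ≤ (ofCoeffs l).coeff j := by
  induction l generalizing j with
  | nil => simp [ofCoeffs]
  | cons x l ih =>
    rcases j with _ | j
    · simpa [ofCoeffs] using h x (by simp)
    · rw [ofCoeffs, coeff_add, coeff_X_mul, coeff_C_succ, zero_add]
      exact ih (fun y hy => h y (List.mem_cons_of_mem x hy)) j

theorem ofCoeffs_mulLinearAux (a b c : ℤ) (l : List ℤ) :
    ofCoeffs (mulLinearAux a b c l) =
      C (a : ℝ) * C (c : ℝ) + (C (a : ℝ) * X + C (b : ℝ)) * ofCoeffs l := by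
  induction l generalizing c with
  | nil => simp [mulLinearAux, ofCoeffs]
  | cons x l ih =>
    rw [mulLinearAux, ofCoeffs, ofCoeffs, ih]
    push_cast
    simp only [C_add, C_mul]
    ring

theorem ofCoeffs_addCoeffs (l l' : List ℤ) :
    ofCoeffs (addCoeffs l l') = ofCoeffs l + ofCoeffs l' := by
  induction l generalizing l' with
  | nil => simp [addCoeffs, ofCoeffs]
  | cons x l ih =>
    cases l' with
    | nil => simp [addCoeffs, ofCoeffs]
    | cons y l' =>
      rw [addCoeffs, ofCoeffs, ofCoeffs, ofCoeffs, ih]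
      push_cast
      rw [C_add]
      ring

theorem ofCoeffs_map_mul (c : ℤ) (l : List ℤ) :
    ofCoeffs (l.map (c * ·)) = C (c : ℝ) * ofCoeffs l := by
  induction l with
  | nil => simp [ofCoeffs]
  | cons x l ih =>
    rw [List.map_cons, ofCoeffs, ofCoeffs, ih]
    push_cast
    rw [C_mul]
    ring

theorem ofCoeffs_prodLinear (a b : ℕ → ℤ) (d : ℕ) :
    ofCoeffs (prodLinear a b d) =
      ∏ i ∈ Finset.range d, (C (a i : ℝ) * X + C (b i : ℝ)) := by
  induction d with
  | zero => simp [prodLinear, ofCoeffs]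
  | succ d ih =>
    rw [prodLinear, ofCoeffs_mulLinearAux, ih, Finset.prod_range_succ]
    simp [mul_comm]

/-- The coefficient list of `hypersimplexThreeNumerator m d`. -/
def hypersimplexThreeCoeffs (m d : ℕ) : List ℤ :=
  addCoeffs (prodLinear (fun i => 3 * m - (i + 1)) (fun i => i + 1) d)
    (addCoeffs ((prodLinear (fun i => 2 * m - i) (fun i => i) d).map (-(d + 1 : ℤ) * ·))
      ((prodLinear (fun i => m - (i - 1)) (fun i => i - 1) d).map
        (((d + 1).choose 2 : ℤ) * ·)))

/-- The polynomial `B` such that `B (t / (t + 1)) (t + 1)^d / d!` is the number of lattice points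
of `t m Δ_{3,d+1}`. -/
noncomputable def hypersimplexThreeNumerator (m d : ℕ) : ℝ[X] :=
  ∏ i ∈ Finset.range d, linFactor (3 * m) ((i : ℝ) + 1) -
    C ((d : ℝ) + 1) * ∏ i ∈ Finset.range d, linFactor (2 * m) (i : ℝ) +
    C ((d + 1).choose 2 : ℝ) * ∏ i ∈ Finset.range d, linFactor m ((i : ℝ) - 1)

theorem ofCoeffs_hypersimplexThreeCoeffs (m d : ℕ) :
    ofCoeffs (hypersimplexThreeCoeffs m d) = hypersimplexThreeNumerator m d := by
  rw [hypersimplexThreeCoeffs, ofCoeffs_addCoeffs, ofCoeffs_addCoeffs, ofCoeffs_map_mul,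
    ofCoeffs_map_mul, ofCoeffs_prodLinear, ofCoeffs_prodLinear, ofCoeffs_prodLinear]
  simp only [hypersimplexThreeNumerator, linFactor]
  push_cast
  rw [C_neg]
  ring

theorem hypersimplexThreeCoeffs_nonneg : ∀ m ∈ Finset.Icc 3 15,
    ∀ d ∈ Finset.Icc (2 * m - 1) (2 * m), ∀ x ∈ hypersimplexThreeCoeffs m d, 0 ≤ x := by
  decide +kernel

theorem hypersimplexThreeNumerator_coeff_nonneg_of_lt (m d : ℕ) (hm : 3 ≤ m) (hm' : m < 16)
    (hd : 2 * m ≤ d + 1) (hd' : d ≤ 2 * m) (j : ℕ) :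
    0 ≤ (hypersimplexThreeNumerator m d).coeff j := by
  rw [← ofCoeffs_hypersimplexThreeCoeffs]
  exact ofCoeffs_coeff_nonneg _ (hypersimplexThreeCoeffs_nonneg m
    (Finset.mem_Icc.2 ⟨hm, by omega⟩) d (Finset.mem_Icc.2 ⟨by omega, hd'⟩)) j

/-! ### The main estimate for k = 3 with m ≥ 16 -/

/-- The first three terms of the binomial expansion of (1 + 1/2)^q. -/
theorem le_three_halves_pow (q : ℕ) :
    1 + (q : ℝ) / 2 + q * (q - 1) / 8 ≤ (3 / 2 : ℝ) ^ q := by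
  induction q with
  | zero => simp
  | succ q ih =>
    rw [pow_succ]
    push_cast
    have : (0 : ℝ) ≤ q * (q - 1) := by
      rcases q with _ | q
      · simp
      · push_cast; ring_nf; positivity
    nlinarith

theorem le_three_halves_pow_mul (q r : ℕ) (hr : 1 ≤ r) (h : 6 ≤ q + r) :
    (9 / 4 : ℝ) * (q + r) ≤ (3 / 2) ^ (q + 2) * r := by
  have h1 := le_three_halves_pow q
  have hr' : (1 : ℝ) ≤ r := by exact_mod_cast hr
  have h2 := mul_le_mul_of_nonneg_right h1 (by linarith : (0 : ℝ) ≤ r)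
  rw [pow_add]
  have h3 : (q : ℝ) + r ≤ (1 + (q : ℝ) / 2 + q * (q - 1) / 8) * r := by
    rcases Nat.lt_or_ge r 2 with h | h
    · obtain rfl : r = 1 := by omega
      have : (5 : ℝ) ≤ q := by exact_mod_cast (by omega : 5 ≤ q)
      push_cast
      nlinarith
    · have h4 : (2 : ℝ) ≤ r := by exact_mod_cast h
      rcases q with _ | q
      · simp
      · have hq : (0 : ℝ) ≤ q := q.cast_nonneg
        push_cast
        nlinarith [mul_nonneg hq hq, mul_nonneg (mul_nonneg hq hq) (by linarith : (0 : ℝ) ≤ r - 2),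
          mul_nonneg hq (by linarith : (0 : ℝ) ≤ r - 2)]
  nlinarith

-- Passing from c = 2M to c = 3M turns v into (3/2)v + 1/2. In degrees at least 4 the growth of
-- (3/2)^j suffices. In degrees 2 and 3 it does not yet, and the two largest slopes v 0 and v 1 give
-- explicit lower bounds on the first coefficients of P.
set_option maxHeartbeats 1000000 in
theorem coeffDominated_three_two_esymmPoly (M K : ℝ) (hM : 16 ≤ M) (D : ℕ)
    (hD : 2 * M - 3 ≤ D) (hK0 : 0 ≤ K)
    (hK : K ≤ 8 / 3 * M + 3 / 2) (v : ℕ → ℝ) (hv : ∀ i < D, 0 ≤ v i)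
    (hv0 : v 0 = M - 1) (hv1 : v 1 = 2 / 3 * M - 1) :
    CoeffDominated
      ((C K * X + C 0) * ((C (2 * M - 1) * X + C 1) * esymmPoly v D))
      ((C (3 * M - 1) * X + C 1) *
        ((C (1 / 2) * X + C 1) * esymmPoly (fun i => 3 / 2 * v i + 1 / 2) D)) := by
  have hDn : 29 ≤ D := by
    have : (29 : ℝ) ≤ D := by linarith
    exact_mod_cast this
  set P := esymmPoly v D with hPdef
  set Q := esymmPoly (fun i => 3 / 2 * v i + 1 / 2) D
  have hP : ∀ j, 0 ≤ P.coeff j := esymmPoly_coeff_nonneg v D hv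
  have hP0 : P.coeff 0 = 1 := esymmPoly_coeff_zero _ _
  have hQ0 : Q.coeff 0 = 1 := esymmPoly_coeff_zero _ _
  have hPz : ∀ j, D < j → P.coeff j = 0 := fun j => esymmPoly_coeff_eq_zero v D j
  have hQn : ∀ j, 0 ≤ Q.coeff j := esymmPoly_coeff_nonneg _ D fun i hi => by
    have := hv i hi
    positivity
  have hQ : ∀ j : ℕ, (3 / 2 : ℝ) ^ (j + 1) * P.coeff (j + 1) +
      (3 / 2) ^ j * (1 / 2) * ((D : ℝ) - j) * P.coeff j ≤ Q.coeff (j + 1) :=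
    le_esymmPoly_affine_coeff_succ v (3 / 2) (1 / 2) (by norm_num) (by norm_num) D hv
  have hQ' : ∀ j : ℕ, (3 / 2 : ℝ) ^ j * P.coeff j ≤ Q.coeff j := by
    intro j
    rcases j with _ | j
    · rw [hP0, hQ0]; simp
    · rcases Nat.lt_or_ge D j with h | h
      · rw [hPz (j + 1) (by omega), mul_zero]; exact hQn _
      · have : (0 : ℝ) ≤ (D : ℝ) - j := sub_nonneg.2 (by exact_mod_cast h)
        have := hP j
        have : 0 ≤ (3 / 2 : ℝ) ^ j * (1 / 2) * ((D : ℝ) - j) * P.coeff j := by positivity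
        linarith [hQ j]
  -- The extra factor acts like one more index with v = 0, so D + 1 replaces D in the lower bounds.
  set R := (C (1 / 2) * X + C 1) * Q with hRdef
  have hR0 : R.coeff 0 = 1 := by rw [hRdef, coeff_linear_mul_zero, hQ0, one_mul]
  have hR : ∀ j : ℕ, (3 / 2 : ℝ) ^ (j + 1) * P.coeff (j + 1) +
      (3 / 2) ^ j * (1 / 2) * ((D : ℝ) + 1 - j) * P.coeff j ≤ R.coeff (j + 1) := by
    intro j
    rw [hRdef, coeff_linear_mul_succ]
    linarith [hQ j, hQ' j]
  -- bounds for the first coefficients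
  obtain ⟨E, hE⟩ : ∃ E, D = E + 1 + 1 := ⟨D - 2, by omega⟩
  have hP1 : v 0 + v 1 ≤ P.coeff 1 := by
    have h2 := esymmPoly_coeff_nonneg (fun i => v (i + 1 + 1)) E
      (fun i hi => hv (i + 1 + 1) (by omega)) 1
    rw [hPdef, hE, esymmPoly_succ', coeff_linear_mul_succ, esymmPoly_coeff_zero, zero_add,
      esymmPoly_succ', ← zero_add 1, coeff_linear_mul_succ, esymmPoly_coeff_zero]
    simp only [zero_add] at h2 ⊢
    linarith
  have hP2 : v 0 * (P.coeff 1 - v 0) ≤ P.coeff 2 := by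
    have h2 := esymmPoly_coeff_nonneg (fun i => v (i + 1)) (E + 1)
      (fun i hi => hv (i + 1) (by omega)) 2
    rw [hPdef, hE, esymmPoly_succ', coeff_linear_mul_succ, coeff_linear_mul_succ _ _ _ 1,
      esymmPoly_coeff_zero, zero_add]
    simp only [one_add_one_eq_two]
    linarith
  rw [hv0, hv1] at hP1
  rw [hv0] at hP2
  have hLn : ∀ j, 0 ≤ ((C (2 * M - 1) * X + C 1) * P).coeff j := by
    intro j
    rcases j with _ | j
    · rw [coeff_linear_mul_zero, hP0]; norm_num
    · rw [coeff_linear_mul_succ]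
      exact add_nonneg (mul_nonneg (by linarith) (hP _)) (mul_nonneg zero_le_one (hP _))
  intro j
  rcases j with _ | j
  · rw [coeff_linear_mul_zero, coeff_linear_mul_zero (3 * M - 1), hR0]; simp
  rw [coeff_linear_mul_succ, coeff_linear_mul_succ (3 * M - 1), zero_mul, add_zero,
    abs_of_nonneg (mul_nonneg hK0 (hLn j))]
  rcases j with _ | j
  · have h1 := hR 0
    rw [coeff_linear_mul_zero, hR0, hP0]
    rw [hP0] at h1
    simp only [zero_add, pow_zero, pow_one, Nat.cast_zero] at h1 ⊢
    linarith
  rw [coeff_linear_mul_succ]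
  have hKM : K * (2 * M - 1) ≤ (8 / 3 * M + 3 / 2) * (2 * M - 1) :=
    mul_le_mul_of_nonneg_right hK (by linarith)
  rcases j with _ | _ | j
  · have h0 := hR 0
    have h1 := hR 1
    rw [hP0] at h0 ⊢
    simp only [zero_add, pow_zero, pow_one, Nat.cast_zero, Nat.cast_one, one_add_one_eq_two,
      mul_one, one_mul] at h0 h1 ⊢
    have h2 := hP 2
    have h3 : (3 * M - 1) * (3 / 2 * P.coeff 1 + 1 / 2 * (2 * M - 2)) ≤
        (3 * M - 1) * R.coeff 1 :=
      mul_le_mul_of_nonneg_left (by linarith) (by linarith)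
    have h4 : (3 / 2 * (1 / 2) * (2 * M - 3)) * P.coeff 1 ≤
        (3 / 2 * (1 / 2) * ((D : ℝ) + 1 - 1)) * P.coeff 1 :=
      mul_le_mul_of_nonneg_right (by linarith) (hP 1)
    have h5 : K * P.coeff 1 ≤ (8 / 3 * M + 3 / 2) * P.coeff 1 :=
      mul_le_mul_of_nonneg_right hK (hP 1)
    have h6 : (10 / 3 * M - 21 / 4) * (5 / 3 * M - 2) ≤ (10 / 3 * M - 21 / 4) * P.coeff 1 :=
      mul_le_mul_of_nonneg_left (by linarith) (by linarith)
    nlinarith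
  · have h0 := hR 1
    have h1 := hR 2
    simp only [zero_add, pow_one, Nat.cast_one, Nat.cast_ofNat, one_add_one_eq_two] at h0 h1 ⊢
    have hp3 := hP (2 + 1)
    have h3 : (3 * M - 1) * ((3 / 2) ^ 2 * P.coeff 2 +
          (3 / 2) * (1 / 2) * (2 * M - 3) * P.coeff 1) ≤
        (3 * M - 1) * R.coeff 2 := by
      refine mul_le_mul_of_nonneg_left (le_trans ?_ h0) (by linarith)
      have := mul_le_mul_of_nonneg_right (by linarith : (2 * M - 3 : ℝ) ≤ (D : ℝ) + 1 - 1) (hP 1)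
      linarith
    have h4 : ((3 / 2) ^ 2 * (1 / 2) * (2 * M - 4)) * P.coeff 2 ≤
        ((3 / 2) ^ 2 * (1 / 2) * ((D : ℝ) + 1 - 2)) * P.coeff 2 :=
      mul_le_mul_of_nonneg_right (by linarith) (hP 2)
    have h5 : K * P.coeff 2 ≤ (8 / 3 * M + 3 / 2) * P.coeff 2 :=
      mul_le_mul_of_nonneg_right hK (hP 2)
    have h6 : K * (2 * M - 1) * P.coeff 1 ≤
        (8 / 3 * M + 3 / 2) * (2 * M - 1) * P.coeff 1 :=
      mul_le_mul_of_nonneg_right hKM (hP 1)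
    -- The constant comes from P_1 ≥ (5/3)M - 2, which yields M - 1 ≤ (13/20) P_1.
    have h7 : 7 / 20 * (M - 1) * P.coeff 1 ≤ P.coeff 2 := by
      have : 7 / 20 * P.coeff 1 ≤ P.coeff 1 - (M - 1) := by linarith
      have := mul_le_mul_of_nonneg_left this (by linarith : (0 : ℝ) ≤ M - 1)
      linarith
    have h8 : (19 / 3 * M - 33 / 4) * (7 / 20 * (M - 1) * P.coeff 1) ≤
        (19 / 3 * M - 33 / 4) * P.coeff 2 :=
      mul_le_mul_of_nonneg_left h7 (by linarith)
    have h9 : 0 ≤ ((19 / 3 * M - 33 / 4) * (7 / 20 * (M - 1)) +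
        (3 * M - 1) * ((3 / 2) * (1 / 2) * (2 * M - 3)) -
        (8 / 3 * M + 3 / 2) * (2 * M - 1)) * P.coeff 1 :=
      mul_nonneg (by nlinarith) (hP 1)
    linarith
  · have h0 := hR (j + 2)
    have h1 := hR (j + 2 + 1)
    rcases Nat.lt_or_ge D (j + 2) with h | h
    · have z1 := hPz (j + 2) h
      have z2 := hPz (j + 2 + 1) (by omega)
      have z3 := hPz (j + 2 + 1 + 1) (by omega)
      rw [z1, z2] at h0
      rw [z2, z3] at h1
      have h2 : 0 ≤ (3 * M - 1) * R.coeff (j + 2 + 1) := mul_nonneg (by linarith) (by linarith)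
      change _ ≤ (3 * M - 1) * R.coeff (j + 2 + 1) + 1 * R.coeff (j + 2 + 1 + 1)
      change K * ((2 * M - 1) * P.coeff (j + 2) + 1 * P.coeff (j + 2 + 1)) ≤ _
      rw [z1, z2]
      linarith
    · change K * ((2 * M - 1) * P.coeff (j + 2) + 1 * P.coeff (j + 2 + 1)) ≤
        (3 * M - 1) * R.coeff (j + 2 + 1) + 1 * R.coeff (j + 2 + 1 + 1)
      have hR2 : 0 ≤ R.coeff (j + 2 + 1 + 1) := by
        refine le_trans ?_ h1
        rcases Nat.lt_or_ge D (j + 2 + 1) with h' | h'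
        · rw [hPz _ h', hPz _ (by omega)]; simp
        · have : (0 : ℝ) ≤ (D : ℝ) + 1 - (j + 2 + 1 : ℕ) := by
            have : ((j + 2 + 1 : ℕ) : ℝ) ≤ D := by exact_mod_cast h'
            linarith
          have := hP (j + 2 + 1)
          have := hP (j + 2 + 1 + 1)
          positivity
      obtain ⟨r, hr⟩ := Nat.exists_eq_add_of_le h
      have hr' : (D : ℝ) = j + 2 + r := by rw [hr]; push_cast; ring
      -- Here j + (r + 1) = D - 1, which is at least 2M - 4.
      have h2 := le_three_halves_pow_mul j (r + 1) (by omega) (by omega)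
      have h3 : (9 / 4 : ℝ) * (2 * M - 4) ≤ (3 / 2) ^ (j + 2) * (r + 1) := by
        push_cast at h2
        linarith
      have h4 : K * (2 * M - 1) ≤ (3 * M - 1) * ((3 / 2) ^ (j + 2) * (1 / 2) * (r + 1)) := by
        have := mul_le_mul_of_nonneg_left h3 (by linarith : (0 : ℝ) ≤ (3 * M - 1) * (1 / 2))
        have hM2 : (8 / 3 * M + 3 / 2) * (2 * M - 1) ≤
            (3 * M - 1) * (1 / 2) * (9 / 4 * (2 * M - 4)) := by nlinarith
        linarith
      have h5 : K ≤ (3 * M - 1) * (3 / 2) ^ (j + 2 + 1) := by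
        have : (3 / 2 : ℝ) ≤ (3 / 2) ^ (j + 2 + 1) := le_self_pow₀ (by norm_num) (by omega)
        have := mul_le_mul_of_nonneg_left this (by linarith : (0 : ℝ) ≤ 3 * M - 1)
        linarith
      have h6 := mul_le_mul_of_nonneg_right h4 (hP (j + 2))
      have h7 := mul_le_mul_of_nonneg_right h5 (hP (j + 2 + 1))
      have h8 := mul_le_mul_of_nonneg_left h0 (by linarith : (0 : ℝ) ≤ 3 * M - 1)
      have e : (D : ℝ) + 1 - (j + 2 : ℕ) = r + 1 := by rw [hr']; push_cast; ring
      rw [e] at h8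
      linarith

/-! ### Comparing the terms of the alternating sum -/

theorem CoeffDominated.of_nonneg {p : ℝ[X]} (h : ∀ j, 0 ≤ p.coeff j) : CoeffDominated p p :=
  fun j => (abs_of_nonneg (h j)).le

/-- The slopes -(1+t) on the left are negative and cannot be compared factor by factor with m - 1 -
t. After reversal they become l - t, and l ≤ m - 1 suffices. The constant is absorbed by the last
factor. -/
theorem coeffDominated_tail (m l : ℕ) (h : l + 1 ≤ m) :
    CoeffDominated
      ((∏ t ∈ Finset.range l, linFactor m ((m : ℝ) + 1 + t)) * C ((m : ℝ) + 1 + l))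
      (∏ t ∈ Finset.range (l + 1), linFactor (2 * m) ((m : ℝ) + 1 + t)) := by
  have hm : (l : ℝ) + 1 ≤ m := by exact_mod_cast h
  rw [Finset.prod_range_succ]
  refine CoeffDominated.mul ?_ ?_
  · have h1 := coeffDominated_prod_reverse ((m : ℝ) + 1) 1 (by positivity) zero_le_one l
    have e : ∏ t ∈ Finset.range l, linFactor m ((m : ℝ) + 1 + t) =
        ∏ t ∈ Finset.range l, (C (-(1 + (t : ℝ))) * X + C ((m : ℝ) + 1 + t)) :=
      Finset.prod_congr rfl fun t _ => by
        rw [linFactor, show (m : ℝ) - (m + 1 + t) = -(1 + t) by ring]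
    rw [e]
    refine h1.trans (CoeffDominated.prod _ _ _ fun t ht => CoeffDominated.linear ?_ ?_)
    · have : (t : ℝ) + 1 ≤ l := by exact_mod_cast Finset.mem_range.1 ht
      rw [abs_of_nonneg (by linarith)]
      linarith
    · exact (abs_of_nonneg (by positivity)).le
  · have := CoeffDominated.linear (a := 0) (b := (m : ℝ) + 1 + l) (a' := 2 * m - (m + 1 + l))
      (b' := (m : ℝ) + 1 + l) (by rw [abs_zero]; linarith) (abs_of_nonneg (by positivity)).le
    rwa [C_0, zero_mul, zero_add] at this

theorem coeffDominated_prod_linFactor_self (m : ℕ) :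
    CoeffDominated (∏ i ∈ Finset.range m, linFactor m ((i : ℝ) + 1))
      (∏ i ∈ Finset.range m, linFactor m ((i : ℝ) + 1)) := by
  refine CoeffDominated.prod _ _ _ fun i hi => CoeffDominated.linear ?_ ?_
  · have : (i : ℝ) + 1 ≤ m := by exact_mod_cast Finset.mem_range.1 hi
    exact (abs_of_nonneg (by linarith)).le
  · exact (abs_of_nonneg (by positivity)).le

theorem coeffDominated_linear_mul_prod (m : ℕ) (hm : 2 ≤ m) (a b : ℝ) (ha : |a| ≤ (m : ℝ) + 1)
    (hb : |b| ≤ 1) :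
    CoeffDominated ((C a * X + C b) * ∏ i ∈ Finset.range m, linFactor m ((i : ℝ) + 1))
      (∏ i ∈ Finset.range m, linFactor (2 * m) ((i : ℝ) + 1)) :=
  ((CoeffDominated.linear ha hb).mul (coeffDominated_prod_linFactor_self m)).trans
    (coeffDominated_prod_linFactor_self_two_mul m hm)

/-- With c = d = m + l + 1, the factor i = 0 and the binomial d + 1 combine to (c+1)my. Moving a
constant c to the tail leaves the slope (c+1)m/c ≤ m + 1, as m ≤ c. -/
theorem coeffDominated_two (m l : ℕ) (hm : 2 ≤ m) (hl : l + 1 ≤ m) :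
    CoeffDominated
      (C (((m + l + 1 : ℕ) : ℝ) + 1) * ∏ i ∈ Finset.range (m + l + 1), linFactor m (i : ℝ))
      (∏ i ∈ Finset.range (m + l + 1), linFactor (2 * m) ((i : ℝ) + 1)) := by
  set c : ℝ := (m : ℝ) + 1 + l with hc
  have hc0 : 0 < c := by positivity
  have e1 : C (((m + l + 1 : ℕ) : ℝ) + 1) * ∏ i ∈ Finset.range (m + l + 1), linFactor m (i : ℝ) =
      ((C ((c + 1) * m / c) * X + C 0) * ∏ i ∈ Finset.range m, linFactor m ((i : ℝ) + 1)) *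
        ((∏ t ∈ Finset.range l, linFactor m ((m : ℝ) + 1 + t)) * C c) := by
    have e2 : (C ((c + 1) * m / c) * X + C 0 : ℝ[X]) * C c = C (c + 1) * linFactor m 0 := by
      rw [linFactor, C_0, add_zero, add_zero, sub_zero, mul_right_comm, ← C_mul,
        div_mul_cancel₀ _ hc0.ne', C_mul, mul_assoc]
    rw [Finset.prod_range_succ', Finset.prod_range_add, show ((m + l + 1 : ℕ) : ℝ) = c by
      rw [hc]; push_cast; ring]
    push_cast
    simp only [show ∀ t : ℕ, (m : ℝ) + t + 1 = m + 1 + t from fun t => by ring]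
    linear_combination (-(∏ i ∈ Finset.range m, linFactor m ((i : ℝ) + 1)) *
      ∏ t ∈ Finset.range l, linFactor m ((m : ℝ) + 1 + t)) * e2
  have e3 : ∏ i ∈ Finset.range (m + l + 1), linFactor (2 * m) ((i : ℝ) + 1) =
      (∏ i ∈ Finset.range m, linFactor (2 * m) ((i : ℝ) + 1)) *
        ∏ t ∈ Finset.range (l + 1), linFactor (2 * m) ((m : ℝ) + 1 + t) := by
    rw [add_assoc, Finset.prod_range_add]
    push_cast
    simp only [show ∀ t : ℕ, (m : ℝ) + t + 1 = m + 1 + t from fun t => by ring]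
  rw [e1, e3]
  refine (coeffDominated_linear_mul_prod m hm _ _ ?_ (by simp)).mul (coeffDominated_tail m l hl)
  rw [abs_of_nonneg (by positivity), div_le_iff₀ hc0, hc]
  have : (0 : ℝ) ≤ l := l.cast_nonneg
  nlinarith

/-- Here c = d - 1. The factor i = -1 is (m+1)y - 1, which fits `coeffDominated_linear_mul_prod`.
The remaining monomials in y compare because 3(c+1)/(2c) ≤ 2, that is, c ≥ 3. -/
theorem coeffDominated_three_third (m l : ℕ) (hm : 3 ≤ m) (hl : l + 2 ≤ m) :
    CoeffDominated
      (C (3 * ((m + l + 2 + 1).choose 2 : ℝ)) *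
        ∏ i ∈ Finset.range (m + l + 2), linFactor m ((i : ℝ) - 1))
      (C (((m + l + 2 : ℕ) : ℝ) + 1) *
        ∏ i ∈ Finset.range (m + l + 2), linFactor (2 * m) (i : ℝ)) := by
  set c : ℝ := (m : ℝ) + 1 + l with hc
  have hc0 : 0 < c := by positivity
  have hm' : (3 : ℝ) ≤ m := by exact_mod_cast hm
  have hl0 : (0 : ℝ) ≤ l := l.cast_nonneg
  have hch : ((m + l + 2 + 1).choose 2 : ℝ) = (c + 2) * (c + 1) / 2 := by
    rw [Nat.cast_choose_two, hc]
    push_cast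
    ring
  have e1 : C (3 * ((m + l + 2 + 1).choose 2 : ℝ)) *
        ∏ i ∈ Finset.range (m + l + 2), linFactor m ((i : ℝ) - 1) =
      (C (3 * (c + 2) * (c + 1) * m / (2 * c)) * X + C 0) *
        (((C ((m : ℝ) + 1) * X + C (-1)) * ∏ i ∈ Finset.range m, linFactor m ((i : ℝ) + 1)) *
        ((∏ t ∈ Finset.range l, linFactor m ((m : ℝ) + 1 + t)) * C c)) := by
    have e2 : (C (3 * (c + 2) * (c + 1) * m / (2 * c)) * X + C 0 : ℝ[X]) * C c =
        C (3 * ((c + 2) * (c + 1) / 2)) * linFactor m 0 := by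
      rw [linFactor, C_0, add_zero, add_zero, sub_zero, mul_right_comm, ← C_mul, ← mul_assoc,
        ← C_mul]
      congr 2
      field_simp
    rw [Finset.prod_range_succ', Finset.prod_range_succ', Finset.prod_range_add, hch]
    push_cast
    simp only [add_sub_cancel_right,
      show ∀ t : ℕ, (m : ℝ) + t + 1 = m + 1 + t from fun t => by ring]
    rw [show (1 - 1 : ℝ) = 0 by ring, show (0 - 1 : ℝ) = -1 by ring,
      show linFactor m (-1) = C ((m : ℝ) + 1) * X + C (-1) by rw [linFactor, sub_neg_eq_add]]
    linear_combination (-(∏ i ∈ Finset.range m, linFactor m ((i : ℝ) + 1)) *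
      (C ((m : ℝ) + 1) * X + C (-1)) *
      ∏ t ∈ Finset.range l, linFactor m ((m : ℝ) + 1 + t)) * e2
  have e3 : C (((m + l + 2 : ℕ) : ℝ) + 1) *
        ∏ i ∈ Finset.range (m + l + 2), linFactor (2 * m) (i : ℝ) =
      (C ((c + 2) * (2 * m)) * X + C 0) *
        ((∏ i ∈ Finset.range m, linFactor (2 * m) ((i : ℝ) + 1)) *
        ∏ t ∈ Finset.range (l + 1), linFactor (2 * m) ((m : ℝ) + 1 + t)) := by
    rw [Finset.prod_range_succ', add_assoc m l 1, Finset.prod_range_add]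
    push_cast
    simp only [show ∀ t : ℕ, (m : ℝ) + t + 1 = m + 1 + t from fun t => by ring]
    rw [show linFactor (2 * m) 0 = C (2 * (m : ℝ)) * X by
      rw [linFactor, C_0, add_zero, sub_zero], C_0, add_zero, C_mul (a := c + 2),
      show (m : ℝ) + l + 2 + 1 = c + 2 by rw [hc]; ring]
    ring
  rw [e1, e3]
  refine (CoeffDominated.linear ?_ (by simp)).mul ((coeffDominated_linear_mul_prod m (by omega) _ _
    (abs_of_nonneg (by positivity)).le (by simp)).mul (coeffDominated_tail m l (by omega)))
  rw [abs_of_nonneg (by positivity), div_le_iff₀ (by positivity)]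
  have h1 : 0 ≤ (c + 2) * m * (c - 3) := by
    have : 0 ≤ (c - 3) := by linarith
    positivity
  nlinarith

/-- The factors i = 2, ..., d-1 common to both products are written through slopes v. The factors i
= 0, 1 on the left and i = 1, d on the right stay separate; since d ≤ 2m, the normalized slope 3m/d
- 1 of the last is at least 1/2. -/
theorem coeffDominated_three_second (m d : ℕ) (hm : 16 ≤ m) (hd : 2 * m ≤ d + 1)
    (hd' : d ≤ 2 * m) :
    CoeffDominated
      (C (4 / 3 * ((d : ℝ) + 1)) * ∏ i ∈ Finset.range d, linFactor (2 * m) (i : ℝ))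
      (∏ i ∈ Finset.range d, linFactor (3 * m) ((i : ℝ) + 1)) := by
  obtain ⟨D, rfl⟩ : ∃ D, d = D + 2 := ⟨d - 2, by omega⟩
  set M : ℝ := (m : ℝ) with hMdef
  have hM : (16 : ℝ) ≤ M := by rw [hMdef]; exact_mod_cast hm
  have hD : 2 * M - 3 ≤ D := by
    have : (2 * M : ℝ) ≤ D + 2 + 1 := by rw [hMdef]; exact_mod_cast hd
    linarith
  have hD' : (D : ℝ) + 2 ≤ 2 * M := by rw [hMdef]; exact_mod_cast hd'
  set v : ℕ → ℝ := fun i => 2 * M / ((i : ℝ) + 1 + 1) - 1 with hv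
  have hg : ∀ i : ℕ, (i : ℝ) + 1 + 1 ≠ 0 := fun i => by positivity
  have hv0 : ∀ i < D, 0 ≤ v i := fun i hi => by
    have : (i : ℝ) + 1 ≤ D := by exact_mod_cast hi
    rw [hv]
    dsimp only
    rw [sub_nonneg, le_div_iff₀ (by positivity)]
    linarith
  set c : ℝ := ∏ i ∈ Finset.range D, ((i : ℝ) + 1 + 1) with hc
  have hc0 : 0 ≤ c := Finset.prod_nonneg fun i _ => by positivity
  set d' : ℝ := (D : ℝ) + 2 with hd'def
  have hd'0 : 0 < d' := by positivity
  set K : ℝ := 4 / 3 * (d' + 1) * (2 * M) / d' with hK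
  have hKd : K * d' = 4 / 3 * (d' + 1) * (2 * M) := div_mul_cancel₀ _ hd'0.ne'
  have hK0 : 0 ≤ K := by positivity
  -- K equals (8/3)M + (8/3)M/d', and d' ≥ 2M - 1 bounds the second summand by 3/2.
  have hK1 : K ≤ 8 / 3 * M + 3 / 2 := by
    rw [hK, div_le_iff₀ hd'0]
    nlinarith
  have key := coeffDominated_three_two_esymmPoly M K hM D hD hK0 hK1 v hv0
    (by rw [hv]; norm_num) (by rw [hv]; norm_num; ring)
  have e1 : C (4 / 3 * (((D + 2 : ℕ) : ℝ) + 1)) *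
        ∏ i ∈ Finset.range (D + 2), linFactor (2 * M) (i : ℝ) =
      C (c * d') * ((C K * X + C 0) * ((C (2 * M - 1) * X + C 1) * esymmPoly v D)) := by
    rw [Finset.prod_range_succ', Finset.prod_range_succ']
    push_cast
    rw [prod_linFactor_eq (2 * M) 1 0 _ v D fun i => ⟨hg i, by rw [hv]; ring⟩]
    simp only [one_mul, add_zero, ← hc, linFactor, sub_zero, C_0]
    have : C (c * d') * C K = C (4 / 3 * (d' + 1)) * C c * C (2 * M) := by
      rw [← C_mul, ← C_mul, ← C_mul]
      congr 1
      linear_combination c * hKd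
    linear_combination (-(X * ((C (2 * M - 1) * X + C 1) * esymmPoly v D))) * this
  have e2 : ∏ i ∈ Finset.range (D + 2), linFactor (3 * M) ((i : ℝ) + 1) =
      C c * ((C (3 * M - 1) * X + C 1) *
        (linFactor (3 * M) d' * esymmPoly (fun i => 3 / 2 * v i + 1 / 2) D)) := by
    rw [Finset.prod_range_succ, Finset.prod_range_succ']
    push_cast
    rw [prod_linFactor_eq (3 * M) (3 / 2) (1 / 2) _ v D fun i => ⟨hg i, by rw [hv]; ring⟩,
      show (D : ℝ) + 1 + 1 = d' by rw [hd'def]; ring, ← hc]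
    simp only [zero_add]
    rw [show linFactor (3 * M) 1 = C (3 * M - 1) * X + C 1 from rfl]
    ring
  rw [e1, e2]
  refine ((CoeffDominated.const_self (by positivity)).mul key).trans ?_
  rw [C_mul, mul_assoc, mul_left_comm (C d'), ← mul_assoc (C d')]
  refine (CoeffDominated.const_self hc0).mul ((CoeffDominated.linear ?_ (by simp)).mul
    (CoeffDominated.mul ?_ (CoeffDominated.of_nonneg (esymmPoly_coeff_nonneg _ _ ?_))))
  · exact (abs_of_nonneg (by linarith)).le
  · rw [mul_add, ← mul_assoc, ← C_mul, ← C_mul, mul_one]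
    refine CoeffDominated.linear ?_ ?_
    · rw [abs_of_nonneg (by positivity)]
      linarith
    · exact (abs_of_nonneg hd'0.le).le
  · intro i hi
    have := hv0 i hi
    positivity

theorem hypersimplexThreeNumerator_coeff_nonneg (m d : ℕ) (hm : 3 ≤ m) (hd : 2 * m ≤ d + 1)
    (hd' : d ≤ 2 * m) (j : ℕ) : 0 ≤ (hypersimplexThreeNumerator m d).coeff j := by
  rcases Nat.lt_or_ge m 16 with h | h
  · exact hypersimplexThreeNumerator_coeff_nonneg_of_lt m d hm h hd hd' j
  have h1 := coeffDominated_three_second m d h hd hd' j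
  obtain ⟨l, rfl⟩ : ∃ l, d = m + l + 2 := ⟨d - m - 2, by omega⟩
  have h2 := coeffDominated_three_third m l (by omega) (by omega) j
  rw [hypersimplexThreeNumerator, coeff_add, coeff_sub, coeff_C_mul, coeff_C_mul]
  rw [coeff_C_mul] at h1
  rw [coeff_C_mul, coeff_C_mul] at h2
  have h3 := (le_abs_self _).trans h1
  have h4 := neg_le_of_abs_le h2
  linarith

/-! ### Lattice point formulas for k = 2, 3 and conclusion -/

theorem count_hypersimplex_two (d s : ℕ) (hs : 1 ≤ s) :
    (d.factorial : ℝ) * ((((Fintype.piFinset fun _ : Fin (d + 1) => Finset.range (s + 1)).filter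
        fun p => ∑ i, p i = 2 * s).card : ℕ) : ℝ) =
      ∏ i ∈ Finset.range d, (2 * (s : ℝ) + (i + 1)) -
        ((d : ℝ) + 1) * ∏ i ∈ Finset.range d, ((s : ℝ) + i) := by
  have h := congrArg (Int.cast : ℤ → ℝ) (card_filter_sum_eq d s 2 two_pos (by omega) (by omega))
  rw [Finset.sum_range_succ, Finset.sum_range_one] at h
  have h0 := factorial_mul_choose_eq_prod (2 * s) d
  have h1 := factorial_mul_choose_eq_prod (s - 1) d
  have e1 : 2 * s - (s + 1) * 1 = s - 1 := by omega
  rw [e1, mul_zero, Nat.sub_zero, Nat.choose_zero_right, Nat.choose_one_right] at h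
  push_cast [Nat.cast_sub hs] at h h0 h1
  rw [h]
  simp only [show ∀ i : ℕ, (s : ℝ) - 1 + (i + 1) = s + i from fun i => by ring] at h1
  linear_combination h0 - ((d : ℝ) + 1) * h1

theorem count_hypersimplex_three (d s : ℕ) (hd : 1 ≤ d) (hs : 2 ≤ s) :
    (d.factorial : ℝ) * ((((Fintype.piFinset fun _ : Fin (d + 1) => Finset.range (s + 1)).filter
        fun p => ∑ i, p i = 3 * s).card : ℕ) : ℝ) =
      ∏ i ∈ Finset.range d, (3 * (s : ℝ) + (i + 1)) -
        ((d : ℝ) + 1) * ∏ i ∈ Finset.range d, (2 * (s : ℝ) + i) +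
        ((d + 1).choose 2 : ℝ) * ∏ i ∈ Finset.range d, ((s : ℝ) + (i - 1)) := by
  have h := congrArg (Int.cast : ℤ → ℝ) (card_filter_sum_eq d s 3 three_pos (by omega) (by omega))
  rw [Finset.sum_range_succ, Finset.sum_range_succ, Finset.sum_range_one] at h
  have h0 := factorial_mul_choose_eq_prod (3 * s) d
  have h1 := factorial_mul_choose_eq_prod (2 * s - 1) d
  have h2 := factorial_mul_choose_eq_prod (s - 2) d
  have e1 : 3 * s - (s + 1) * 1 = 2 * s - 1 := by omega
  have e2 : 3 * s - (s + 1) * 2 = s - 2 := by omega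
  rw [e1, e2, mul_zero, Nat.sub_zero, Nat.choose_zero_right, Nat.choose_one_right] at h
  push_cast [Nat.cast_sub hs, Nat.cast_sub (by omega : 1 ≤ 2 * s)] at h h0 h1 h2
  rw [h]
  simp only [show ∀ i : ℕ, 2 * (s : ℝ) - 1 + (i + 1) = 2 * s + i from fun i => by ring] at h1
  simp only [show ∀ i : ℕ, (s : ℝ) - 2 + (i + 1) = s + (i - 1) from fun i => by ring] at h2
  linear_combination h0 - ((d : ℝ) + 1) * h1 + ((d + 1).choose 2 : ℝ) * h2

theorem coeff_zero_prod_linFactor (c : ℝ) (g : ℕ → ℝ) (d : ℕ) :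
    (∏ i ∈ Finset.range d, linFactor c (g i)).coeff 0 = ∏ i ∈ Finset.range d, g i := by
  rw [coeff_zero_prod]
  exact Finset.prod_congr rfl fun i _ => coeff_linear_zero _ _

theorem ehrhartMagicPositive_hypersimplex_two (n : ℕ) (hn : 4 ≤ n) :
    EhrhartMagicPositive (((n / 2 : ℕ) : ℝ) • hypersimplex 2 n) := by
  obtain ⟨d, rfl⟩ : ∃ d, n = d + 1 := ⟨n - 1, by omega⟩
  set m := (d + 1) / 2 with hm
  refine ehrhartMagicPositive_of_eval d
    (∏ i ∈ Finset.range d, linFactor (2 * m) ((i : ℝ) + 1) -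
      C ((d : ℝ) + 1) * ∏ i ∈ Finset.range d, linFactor m (i : ℝ)) ?_ ?_ ?_ ?_
  · exact (natDegree_sub_le _ _).trans (max_le (natDegree_prod_linFactor_le _ _ _)
      ((natDegree_C_mul_le _ _).trans (natDegree_prod_linFactor_le _ _ _)))
  · intro j
    obtain ⟨l, hl⟩ : ∃ l, d = m + l + 1 := ⟨d - m - 1, by omega⟩
    have := coeffDominated_two m l (by omega) (by omega) j
    rw [← hl] at this
    rw [coeff_sub, sub_nonneg]
    exact (le_abs_self _).trans this
  · rw [coeff_sub, coeff_C_mul, coeff_zero_prod_linFactor, coeff_zero_prod_linFactor _ _ d,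
      Finset.prod_eq_zero (f := fun i : ℕ => (i : ℝ)) (i := 0) (Finset.mem_range.2 (by omega))
        (by simp), mul_zero, sub_zero]
    exact Finset.prod_pos fun i _ => by positivity
  · intro t ht
    have htm : 0 < t * m := Nat.mul_pos ht (by omega)
    have ht1 : (t : ℝ) + 1 ≠ 0 := by positivity
    rw [latticePointCount_smul_smul_hypersimplex 2 t m htm, count_hypersimplex_two d _ htm,
      eval_sub, eval_mul, eval_C, mul_sub, mul_left_comm,
      pow_mul_eval_prod_linFactor (2 * m) t ht1 d fun i => (i : ℝ) + 1,
      pow_mul_eval_prod_linFactor m t ht1 d fun i => (i : ℝ)]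
    push_cast
    simp only [mul_comm (t : ℝ), mul_assoc]

theorem ehrhartMagicPositive_hypersimplex_three (n : ℕ) (hn : 6 ≤ n) :
    EhrhartMagicPositive (((n / 2 : ℕ) : ℝ) • hypersimplex 3 n) := by
  obtain ⟨d, rfl⟩ : ∃ d, n = d + 1 := ⟨n - 1, by omega⟩
  set m := (d + 1) / 2 with hm
  refine ehrhartMagicPositive_of_eval d (hypersimplexThreeNumerator m d) ?_
    (hypersimplexThreeNumerator_coeff_nonneg m d (by omega) (by omega) (by omega)) ?_ ?_
  · exact (natDegree_add_le _ _).trans (max_le ((natDegree_sub_le _ _).trans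
      (max_le (natDegree_prod_linFactor_le _ _ _)
      ((natDegree_C_mul_le _ _).trans (natDegree_prod_linFactor_le _ _ _))))
      ((natDegree_C_mul_le _ _).trans (natDegree_prod_linFactor_le _ _ fun i => (i : ℝ) - 1)))
  -- At y = 0 only the first product survives: the others contain a factor with zero constant term,
  -- at i = 0 and i = 1 respectively.
  · rw [hypersimplexThreeNumerator, coeff_add, coeff_sub, coeff_C_mul, coeff_C_mul,
      coeff_zero_prod_linFactor, coeff_zero_prod_linFactor _ _ d,
      coeff_zero_prod_linFactor _ (fun i => (i : ℝ) - 1) d,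
      Finset.prod_eq_zero (f := fun i : ℕ => (i : ℝ)) (i := 0) (Finset.mem_range.2 (by omega))
        (by simp),
      Finset.prod_eq_zero (f := fun i : ℕ => (i : ℝ) - 1) (i := 1)
        (Finset.mem_range.2 (by omega)) (by simp), mul_zero, sub_zero, mul_zero, add_zero]
    exact Finset.prod_pos fun i _ => by positivity
  · intro t ht
    have htm : 2 ≤ t * m := by nlinarith [(by omega : 2 ≤ m)]
    have ht1 : (t : ℝ) + 1 ≠ 0 := by positivity
    rw [latticePointCount_smul_smul_hypersimplex 3 t m (by omega),
      count_hypersimplex_three d _ (by omega) htm, hypersimplexThreeNumerator,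
      eval_add, eval_sub, eval_mul, eval_mul, eval_C, eval_C, mul_add, mul_sub,
      mul_left_comm, mul_left_comm _ ((d + 1).choose 2 : ℝ),
      pow_mul_eval_prod_linFactor (3 * m) t ht1 d fun i => (i : ℝ) + 1,
      pow_mul_eval_prod_linFactor (2 * m) t ht1 d fun i => (i : ℝ),
      pow_mul_eval_prod_linFactor m t ht1 d fun i => (i : ℝ) - 1]
    push_cast
    simp only [mul_comm (t : ℝ), mul_assoc]

theorem mainTheorem7 :
    (∀ n : ℕ, 2 ≤ n → mIndex (hypersimplex 1 n) = ((n - 1 : ℕ) : ℕ∞)) ∧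
    (∀ n : ℕ, 4 ≤ n →
      EhrhartMagicPositive (((n / 2 : ℕ) : ℝ) • hypersimplex 2 n) ∧
      mIndex (hypersimplex 2 n) ≤ ((n / 2 : ℕ) : ℕ∞)) ∧
    (∀ n : ℕ, 6 ≤ n →
      EhrhartMagicPositive (((n / 2 : ℕ) : ℝ) • hypersimplex 3 n) ∧
      mIndex (hypersimplex 3 n) ≤ ((n / 2 : ℕ) : ℕ∞)) :=
  ⟨mIndex_hypersimplex_one,
    fun n hn => ⟨ehrhartMagicPositive_hypersimplex_two n hn,
      mIndex_le (by omega) (ehrhartMagicPositive_hypersimplex_two n hn)⟩,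
    fun n hn => ⟨ehrhartMagicPositive_hypersimplex_three n hn,
      mIndex_le (by omega) (ehrhartMagicPositive_hypersimplex_three n hn)⟩⟩
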